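/- **Setting.** Let $(\mathcal M,g)$ be Kerr spacetime of mass $M>0$ and rotation parameter $a$, signature $(-,+,+,+)$, $G=c=1$, in Boyer–Lindquist coordinates $(t,r,\theta,\phi)$ with $\varepsilon_{tr\theta\phi}<0$. Square brackets on indices denote antisymmetrization with weight one, $A_{[\mu\nu]}=\tfrac12(A_{\mu\nu}-A_{\nu\mu})$, $[\nabla_\alpha,\nabla_\beta]V^\mu=R^\mu{}_{\nu\alpha\beta}V^\nu$, and $A^*_{\mu\nu}=\tfrac12\varepsilon_{\mu\nu\rho\sigma}A^{\rho\sigma}$. Let $\xi=\partial_t$, let $$Y=a\cos\theta\,dr\wedge(dt-a\sin^2\theta\,d\phi)+r\sin\theta\,d\theta\wedge\big((r^2+a^2)\,d\phi-a\,dt\big)$$ be the Killing–Yano tensor, $K_{\mu\nu}=Y_{\mu\lambda}Y^\lambda{}_\nu$, $\mathcal Z=\tfrac14Y^*_{\alpha\beta}Y^{\alpha\beta}$, $L_{\alpha\beta\gamma}=\tfrac23\nabla_{[\alpha}K_{\beta]\gamma}+\tfrac43\varepsilon_{\alpha\beta\gamma\delta}\nabla^\delta\mathcal Z$, and $$Q^{(2)}_{BH}=K_{\mu\nu}p^\mu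 p^\nu+L_{\mu\nu\rho}S^{\mu\nu}p^\rho+\Big[-g_{\alpha\gamma}\big(\xi_\beta\xi_\delta-\tfrac12g_{\beta\delta}\xi^2\big)+\tfrac12Y_\alpha{}^\lambda\big(Y_\gamma{}^\kappa R_{\lambda\beta\kappa\delta}+\tfrac12Y_\lambda{}^\kappa R_{\kappa\beta\gamma\delta}\big)\Big]S^{\alpha\beta}S^{\gamma\delta}.$$ A test body with worldline $x(\tau)$ ($\tau$ proper time, $v=\dot x$, $v_\mu v^\mu=-1$), timelike momentum $p^\mu$ and spin tensor $S^{\mu\nu}=-S^{\nu\mu}$ satisfies the Mathisson–Papapetrou–Dixon equations with spin-induced quadrupole of coupling $\kappa\in\mathbb R$ if $$\frac{Dp^\mu}{d\tau}=-\tfrac12R^\mu{}_{\nu\alpha\beta}v^\nu S^{\alpha\beta}-\tfrac16J^{\alpha\beta\gamma\delta}\nabla^\mu R_{\alpha\beta\gamma\delta},\qquad \frac{DS^{\mu\nu}}{d\tau}=2p^{[\mu}v^{\nu]}+\tfrac43R^{[\mu}{}_{\alpha\beta\gamma}J^{\nu]\alpha\beta\gamma},\qquad p_\mu S^{\mu\nu}=0,$$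 $$J^{\mu\nu\rho\sigma}=\kappa\,\frac{3\,p\cdot v}{(p^2)^2}\,p^{[\mu}S^{\nu]\lambda}S^{[\rho}{}_\lambda p^{\sigma]}.$$ Put $\mathcal S^2=\tfrac12S_{\mu\nu}S^{\mu\nu}$. **Theorem.** In Schwarzschild spacetime ($a=0$), for every $\kappa\in\mathbb R$, the quantity $Q^{(2)}_{BH}$ is conserved up to $O(\mathcal S^3)$ along solutions of these equations. Precisely: let $\mathcal U=\{(t,r,\theta,\phi): r>0,\ r\ne2M,\ 0<\theta<\pi\}$, and let $\mathcal K$ be a compact set of pairs $(x,p)$ with $x\in\mathcal U$ and $g_x(p,p)<0$. Then there are constants $C,\epsilon>0$, depending only on $M,\kappa,\mathcal K$, such that for every solution $(x,p,S)$ whose worldline lies in $\mathcal U$, and every $\tau$ with $(x(\tau),p(\tau))\in\mathcal K$ and $\mathcal S(\tau)\le\epsilon$, the function $Q^{(2)}_{BH}$ along the solution is differentiable at $\tau$ and $$\Big|\frac{dQ^{(2)}_{BH}}{d\tau}(\tau)\Big|\le C\,\mathcal S(\tau)^3.$$ -/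

import Mathlib

noncomputable section

namespace SpinningBody

/-- Coordinates of an event, or components of a vector; over Kerr the coordinates are the
Boyer-Lindquist ones `x 0 = t`, `x 1 = r`, `x 2 = θ`, `x 3 = φ`. -/
abbrev Vec : Type := Fin 4 → ℝ

/-- Components of a tensor with two indices; the position (up or down) of the indices is stated
where a tensor is introduced. -/
abbrev Tensor2 : Type := Fin 4 → Fin 4 → ℝ

/-- A metric in coordinates, `g x μ ν = g_{μν}(x)`. -/
abbrev MetricField : Type := Vec → Matrix (Fin 4) (Fin 4) ℝ

/-- The partial derivative `∂_μ f` at `x`. -/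
def pd (μ : Fin 4) (f : Vec → ℝ) (x : Vec) : ℝ :=
  deriv (fun s : ℝ => f (Function.update x μ s)) (x μ)

/-! ### Tensor calculus of a metric in coordinates -/

/-- `g_{μν} u^μ w^ν`. -/
def dot (g : MetricField) (x : Vec) (u w : Vec) : ℝ :=
  ∑ μ, ∑ ν, g x μ ν * u μ * w ν

/-- The inverse metric `g^{μν}`. -/
def ginv (g : MetricField) (x : Vec) (μ ν : Fin 4) : ℝ := (g x)⁻¹ μ ν

/-- `u_μ = g_{μν} u^ν`. -/
def lower (g : MetricField) (x : Vec) (u : Vec) (μ : Fin 4) : ℝ := ∑ ν, g x μ ν * u ν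

/-- The Christoffel symbol `Γ^μ_{αβ}`. -/
def christoffel (g : MetricField) (x : Vec) (μ α β : Fin 4) : ℝ :=
  (1 / 2) * ∑ l, ginv g x μ l *
    (pd α (fun y => g y l β) x + pd β (fun y => g y l α) x - pd l (fun y => g y α β) x)

/-- The Riemann tensor `R^μ_{ναβ}`, with `[∇_α, ∇_β] V^μ = R^μ_{ναβ} V^ν`. -/
def riemann (g : MetricField) (x : Vec) (μ ν α β : Fin 4) : ℝ :=
  pd α (fun y => christoffel g y μ ν β) x - pd β (fun y => christoffel g y μ ν α) x
    + ∑ l, (christoffel g x μ α l * christoffel g x l ν β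
      - christoffel g x μ β l * christoffel g x l ν α)

/-- The Riemann tensor `R_{μναβ}` with all indices down. -/
def riemannDown (g : MetricField) (x : Vec) (μ ν α β : Fin 4) : ℝ :=
  ∑ l, g x μ l * riemann g x l ν α β

/-- The covariant derivative `∇_l R_{μναβ}`. -/
def nablaRiemann (g : MetricField) (x : Vec) (l μ ν α β : Fin 4) : ℝ :=
  pd l (fun y => riemannDown g y μ ν α β) x
    - ∑ s, (christoffel g x s l μ * riemannDown g x s ν α β
      + christoffel g x s l ν * riemannDown g x μ s α β
      + christoffel g x s l α * riemannDown g x μ ν s β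
      + christoffel g x s l β * riemannDown g x μ ν α s)

/-- The covariant derivative `∇_l T_{μν}` of a tensor field with two lower indices. -/
def nabla2 (g : MetricField) (T : Vec → Tensor2) (x : Vec) (l μ ν : Fin 4) : ℝ :=
  pd l (fun y => T y μ ν) x
    - ∑ s, (christoffel g x s l μ * T x s ν + christoffel g x s l ν * T x μ s)

/-- The permutation symbol, equal to `1` at `(0, 1, 2, 3)`. -/
def permSymbol (μ ν ρ σ : Fin 4) : ℝ :=
  Matrix.det (Matrix.of fun a b : Fin 4 => if ![μ, ν, ρ, σ] a = b then (1 : ℝ) else 0)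

/-- The Levi-Civita tensor `ε_{μνρσ}`, in the orientation in which `ε_{0123}` is negative. -/
def leviCivita (g : MetricField) (x : Vec) (μ ν ρ σ : Fin 4) : ℝ :=
  -(Real.sqrt (-(g x).det) * permSymbol μ ν ρ σ)

/-- `T^{μν}` from `T_{μν}`. -/
def raise2 (g : MetricField) (x : Vec) (T : Tensor2) (μ ν : Fin 4) : ℝ :=
  ∑ α, ∑ β, ginv g x μ α * ginv g x ν β * T α β

/-- The Hodge dual `T^*_{μν} = (1/2) ε_{μνρσ} T^{ρσ}` of a tensor given with lower indices. -/
def hodge (g : MetricField) (x : Vec) (T : Tensor2) (μ ν : Fin 4) : ℝ :=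
  (1 / 2) * ∑ ρ, ∑ σ, leviCivita g x μ ν ρ σ * raise2 g x T ρ σ

/-! ### The Mathisson-Papapetrou-Dixon equations with spin-induced quadrupole

The momentum `p^μ`, the velocity `v^μ` and the spin tensor `S^{μν}` have upper indices. -/

/-- `Θ^{μν} = S^{μl} S^ν_l`. -/
def spinSquare (g : MetricField) (x : Vec) (S : Tensor2) (μ ν : Fin 4) : ℝ :=
  ∑ l, ∑ s, S μ l * S ν s * g x s l

/-- The spin-induced quadrupole
`J^{μνρσ} = κ (3 p·v / (p²)²) p^{[μ} S^{ν]l} S^{[ρ}_l p^{σ]}`, where brackets denote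
antisymmetrization with weight one half. -/
def quadrupole (g : MetricField) (κ : ℝ) (x v p : Vec) (S : Tensor2) (μ ν ρ σ : Fin 4) : ℝ :=
  κ * (3 * dot g x p v / (dot g x p p) ^ 2) * ((1 / 4) *
    (p μ * spinSquare g x S ν ρ * p σ - p ν * spinSquare g x S μ ρ * p σ
      - p μ * spinSquare g x S ν σ * p ρ + p ν * spinSquare g x S μ σ * p ρ))

/-- The force `F^μ = -(1/6) J^{αβγδ} ∇^μ R_{αβγδ}`. -/
def force (g : MetricField) (κ : ℝ) (x v p : Vec) (S : Tensor2) (μ : Fin 4) : ℝ :=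
  -(1 / 6) * ∑ l, ginv g x μ l * ∑ α, ∑ β, ∑ γ, ∑ δ,
    quadrupole g κ x v p S α β γ δ * nablaRiemann g x l α β γ δ

/-- `R^μ_{αβγ} J^{ναβγ}`. -/
def riemannQuadrupole (g : MetricField) (κ : ℝ) (x v p : Vec) (S : Tensor2) (μ ν : Fin 4) : ℝ :=
  ∑ α, ∑ β, ∑ γ, riemann g x μ α β γ * quadrupole g κ x v p S ν α β γ

/-- The torque `L^{μν} = (4/3) R^{[μ}_{αβγ} J^{ν]αβγ}`. -/
def torque (g : MetricField) (κ : ℝ) (x v p : Vec) (S : Tensor2) (μ ν : Fin 4) : ℝ :=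
  (4 / 3) * ((1 / 2) *
    (riemannQuadrupole g κ x v p S μ ν - riemannQuadrupole g κ x v p S ν μ))

/-- On the open set `I` of proper times, the worldline `x` with velocity `v` stays in the
coordinate region `U` and, together with the momentum `p` and the spin tensor `S`, solves the
Mathisson-Papapetrou-Dixon equations at quadrupole order with spin-induced quadrupole of coupling
`κ`, under the Tulczyjew spin supplementary condition. -/
structure IsMPDTrajectory (g : MetricField) (U : Set Vec) (κ : ℝ) (I : Set ℝ)
    (x v p : ℝ → Vec) (S : ℝ → Tensor2) : Prop where
  isOpen : IsOpen I
  mem : ∀ τ ∈ I, x τ ∈ U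
  velocity : ∀ τ ∈ I, ∀ μ, HasDerivAt (fun s => x s μ) (v τ μ) τ
  /-- `τ` is the proper time. -/
  properTime : ∀ τ ∈ I, dot g (x τ) (v τ) (v τ) = -1
  timelike : ∀ τ ∈ I, dot g (x τ) (p τ) (p τ) < 0
  antisymm : ∀ τ ∈ I, ∀ μ ν, S τ μ ν = -S τ ν μ
  /-- The Tulczyjew condition `p_μ S^{μν} = 0`. -/
  tulczyjew : ∀ τ ∈ I, ∀ ν, ∑ μ, lower g (x τ) (p τ) μ * S τ μ ν = 0
  /-- `D p^μ / dτ = -(1/2) R^μ_{ναβ} v^ν S^{αβ} + F^μ`. -/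
  momentum : ∀ τ ∈ I, ∀ μ, HasDerivAt (fun s => p s μ)
    (-(∑ α, ∑ β, christoffel g (x τ) μ α β * v τ α * p τ β)
      - (1 / 2) * ∑ ν, ∑ α, ∑ β, riemann g (x τ) μ ν α β * v τ ν * S τ α β
      + force g κ (x τ) (v τ) (p τ) (S τ) μ) τ
  /-- `D S^{μν} / dτ = 2 p^{[μ} v^{ν]} + L^{μν}`. -/
  spin : ∀ τ ∈ I, ∀ μ ν, HasDerivAt (fun s => S s μ ν)
    (-(∑ α, ∑ β, (christoffel g (x τ) μ α β * v τ α * S τ β ν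
        + christoffel g (x τ) ν α β * v τ α * S τ μ β))
      + (p τ μ * v τ ν - p τ ν * v τ μ)
      + torque g κ (x τ) (v τ) (p τ) (S τ) μ ν) τ

/-- The spin magnitude, the square root of `(1/2) S_{μν} S^{μν}`. -/
def spinMagnitude (g : MetricField) (x : Vec) (S : Tensor2) : ℝ :=
  Real.sqrt ((1 / 2) * ∑ μ, ∑ ν, ∑ α, ∑ β, g x μ α * g x ν β * S μ ν * S α β)

/-! ### The Kerr metric and the deformed quadratic invariant -/

/-- `Σ = r² + a² cos² θ`. -/
def kerrSigma (a : ℝ) (x : Vec) : ℝ := x 1 ^ 2 + a ^ 2 * Real.cos (x 2) ^ 2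

/-- `Δ = r² - 2 M r + a²`. -/
def kerrDelta (M a : ℝ) (x : Vec) : ℝ := x 1 ^ 2 - 2 * M * x 1 + a ^ 2

/-- The Kerr metric `g_{μν}` of mass `M` and rotation parameter `a` in Boyer-Lindquist
coordinates, signature `(-,+,+,+)`. For `a = 0` it is the Schwarzschild metric. -/
def kerrMetric (M a : ℝ) : MetricField := fun x =>
  !![-(1 - 2 * M * x 1 / kerrSigma a x), 0, 0,
      -(2 * M * a * x 1 * Real.sin (x 2) ^ 2 / kerrSigma a x);
    0, kerrSigma a x / kerrDelta M a x, 0, 0;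
    0, 0, kerrSigma a x, 0;
    -(2 * M * a * x 1 * Real.sin (x 2) ^ 2 / kerrSigma a x), 0, 0,
      (x 1 ^ 2 + a ^ 2 + 2 * M * a ^ 2 * x 1 * Real.sin (x 2) ^ 2 / kerrSigma a x)
        * Real.sin (x 2) ^ 2]

/-- The components `Y_{μν}` of the Killing-Yano tensor of Kerr,
`Y = a cos θ dr ∧ (dt - a sin² θ dφ) + r sin θ dθ ∧ ((r² + a²) dφ - a dt)`. -/
def killingYano (a : ℝ) (x : Vec) : Tensor2 :=
  !![0, -(a * Real.cos (x 2)), a * x 1 * Real.sin (x 2), 0;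
    a * Real.cos (x 2), 0, 0, -(a ^ 2 * Real.cos (x 2) * Real.sin (x 2) ^ 2);
    -(a * x 1 * Real.sin (x 2)), 0, 0, x 1 * (x 1 ^ 2 + a ^ 2) * Real.sin (x 2);
    0, a ^ 2 * Real.cos (x 2) * Real.sin (x 2) ^ 2,
      -(x 1 * (x 1 ^ 2 + a ^ 2) * Real.sin (x 2)), 0]

/-- `Y_μ^ν`. -/
def killingYanoMixed (M a : ℝ) (x : Vec) (μ ν : Fin 4) : ℝ :=
  ∑ l, killingYano a x μ l * ginv (kerrMetric M a) x l ν

/-- The Killing tensor `K_{μν} = Y_{μl} Y^l_ν`. -/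
def killingTensor (M a : ℝ) (x : Vec) : Tensor2 := fun μ ν =>
  ∑ l, killingYanoMixed M a x μ l * killingYano a x l ν

/-- The scalar `Z = (1/4) Y^*_{αβ} Y^{αβ}`. -/
def scalarZ (M a : ℝ) (x : Vec) : ℝ :=
  (1 / 4) * ∑ α, ∑ β, hodge (kerrMetric M a) x (killingYano a x) α β *
    raise2 (kerrMetric M a) x (killingYano a x) α β

/-- `L_{αβγ} = (2/3) ∇_{[α} K_{β]γ} + (4/3) ε_{αβγδ} ∇^δ Z`. -/
def tensorL (M a : ℝ) (x : Vec) (α β γ : Fin 4) : ℝ :=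
  (2 / 3) * ((1 / 2) * (nabla2 (kerrMetric M a) (killingTensor M a) x α β γ
      - nabla2 (kerrMetric M a) (killingTensor M a) x β α γ))
    + (4 / 3) * ∑ δ, leviCivita (kerrMetric M a) x α β γ δ *
        ∑ l, ginv (kerrMetric M a) x δ l * pd l (scalarZ M a) x

/-- The Killing vector field `ξ = ∂_t`. -/
def killingVector : Vec := ![1, 0, 0, 0]

/-- `M_{αβγδ} = - g_{αγ} (ξ_β ξ_δ - (1/2) g_{βδ} ξ²)
  + (1/2) Y_α^l (Y_γ^k R_{lβkδ} + (1/2) Y_l^k R_{kβγδ})`. -/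
def tensorM (M a : ℝ) (x : Vec) (α β γ δ : Fin 4) : ℝ :=
  -(kerrMetric M a x α γ *
      (lower (kerrMetric M a) x killingVector β * lower (kerrMetric M a) x killingVector δ
        - (1 / 2) * kerrMetric M a x β δ * dot (kerrMetric M a) x killingVector killingVector))
    + (1 / 2) * ∑ l, killingYanoMixed M a x α l * ∑ k,
        (killingYanoMixed M a x γ k * riemannDown (kerrMetric M a) x l β k δ
          + (1 / 2) * killingYanoMixed M a x l k * riemannDown (kerrMetric M a) x k β γ δ)

/-- Rüdiger's quadratic invariant `Q_R = K_{μν} p^μ p^ν + L_{μνρ} S^{μν} p^ρ` of Kerr. -/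
def ruedigerInvariant (M a : ℝ) (x p : Vec) (S : Tensor2) : ℝ :=
  ∑ μ, ∑ ν, killingTensor M a x μ ν * p μ * p ν
    + ∑ μ, ∑ ν, ∑ ρ, tensorL M a x μ ν ρ * S μ ν * p ρ

/-- The deformed quadratic invariant `Q_BH = Q_R + M_{αβγδ} S^{αβ} S^{γδ}` of Kerr. -/
def quadraticInvariantBH (M a : ℝ) (x p : Vec) (S : Tensor2) : ℝ :=
  ruedigerInvariant M a x p S
    + ∑ α, ∑ β, ∑ γ, ∑ δ, tensorM M a x α β γ δ * S α β * S γ δ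

/-- The region covered by the coordinates `(t, r, θ, φ)` in Schwarzschild spacetime, both outside
and inside the horizon. -/
def schwarzschildPatch (M : ℝ) : Set Vec :=
  {x | 0 < x 1 ∧ x 1 ≠ 2 * M ∧ 0 < x 2 ∧ x 2 < Real.pi}

end SpinningBody

end

open SpinningBody

/-!
In Schwarzschild spacetime `Q_BH` is conserved exactly along the Mathisson-Papapetrou-Dixon
equations, not only up to terms cubic in the spin, because it is the Casimir invariant `-|J|²` of
the total angular momentum (`quadraticInvariantBH_zero`). Here `K_{μν} p^μ p^ν` is minus the square
of the orbital angular momentum, the term with `L_{αβγ}` is its coupling to the spin, and the term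
quadratic in the spin completes the square: the curvature terms in `M_{αβγδ}` are what makes this
true for positive mass.

Each Killing vector field `k` gives a quantity `k_μ p^μ + (1/2) ∇_μ k_ν S^{μν}` that is exactly
conserved for every quadrupole, since its derivative along the body is the contraction of the
quadrupole with the Lie derivative of the Riemann tensor along `k`. For the three rotations these
quantities are the Cartesian components of `J`. Their conservation is used here in the form in
which the components of `J` along the moving spherical frame merely rotate
(`IsMPDTrajectory.hasDerivAt_radial`, `IsMPDTrajectory.hasDerivAt_azimuthal`,
`IsMPDTrajectory.hasDerivAt_polar`), which avoids the angle `φ`. The quadrupole enters only through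
`force_θ_add_torque`, `force_φ_add_torque` and `torque_θ_φ`, and the coupling `κ` is a common factor
there. The bound then holds with any positive constants.
-/

namespace SpinningBody

/-! ### The Schwarzschild metric and its Christoffel symbols -/

/-- The points at which the Schwarzschild metric is given by regular expressions in the
coordinates. It contains `schwarzschildPatch M`; the signs of `r` and `sin θ` play no role in the
computations, so only what is divided by is required not to vanish. -/
def schwarzschildRegular (M : ℝ) : Set Vec :=
  {x | x 1 ≠ 0 ∧ x 1 - 2 * M ≠ 0 ∧ Real.sin (x 2) ≠ 0}

theorem isOpen_schwarzschildRegular (M : ℝ) : IsOpen (schwarzschildRegular M) := by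
  refine IsOpen.inter (isOpen_ne_fun (by fun_prop) (by fun_prop)) (IsOpen.inter ?_ ?_)
  · exact isOpen_ne_fun (f := fun x : Vec => x 1 - 2 * M) (by fun_prop) (by fun_prop)
  · exact isOpen_ne_fun (f := fun x : Vec => Real.sin (x 2)) (by fun_prop) (by fun_prop)

theorem schwarzschildPatch_subset_regular (M : ℝ) :
    schwarzschildPatch M ⊆ schwarzschildRegular M := fun _ hx =>
  ⟨hx.1.ne', sub_ne_zero.2 hx.2.1, (Real.sin_pos_of_pos_of_lt_pi hx.2.2.1 hx.2.2.2).ne'⟩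

/-- Partial derivatives are local: the expressions below hold on an open set only, since
`kerrMetric` takes junk values where a denominator vanishes. -/
theorem pd_congr_of_eqOn {U : Set Vec} (hU : IsOpen U) {f h : Vec → ℝ} (hfh : Set.EqOn f h U)
    {x : Vec} (hx : x ∈ U) (μ : Fin 4) : pd μ f x = pd μ h x := by
  have hc : ContinuousAt (fun s : ℝ => Function.update x μ s) (x μ) :=
    (continuous_const.update μ continuous_id).continuousAt
  refine Filter.EventuallyEq.deriv_eq ?_
  filter_upwards [hc.eventually (hU.mem_nhds (by simpa using hx))] with s hs using hfh hs

/-- The partial derivatives of a function of `r` and `θ` alone. -/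
theorem pd_eq_of_hasDerivAt {F : ℝ → ℝ → ℝ} {x : Vec} {Fr Fθ : ℝ}
    (hr : HasDerivAt (fun r => F r (x 2)) Fr (x 1))
    (hθ : HasDerivAt (fun θ => F (x 1) θ) Fθ (x 2)) (μ : Fin 4) :
    pd μ (fun y => F (y 1) (y 2)) x = ![0, Fr, Fθ, 0] μ := by
  fin_cases μ
  · simp [pd]
  · simpa [pd] using hr.deriv
  · simpa [pd] using hθ.deriv
  · simp [pd]

/-- The diagonal components `g_{μμ}` of the Schwarzschild metric as functions of `r` and `θ`. -/
noncomputable def schwarzschildMetric (M r θ : ℝ) : Fin 4 → ℝ :=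
  ![-((r - 2 * M) / r), r / (r - 2 * M), r ^ 2, r ^ 2 * Real.sin θ ^ 2]

theorem kerrMetric_zero {M : ℝ} {x : Vec} (hx : x ∈ schwarzschildRegular M) :
    kerrMetric M 0 x = Matrix.diagonal (schwarzschildMetric M (x 1) (x 2)) := by
  obtain ⟨h1, h2, h3⟩ := hx
  have h4 : x 1 ^ 2 - 2 * M * x 1 ≠ 0 := by
    have : x 1 ^ 2 - 2 * M * x 1 = x 1 * (x 1 - 2 * M) := by ring
    rw [this]; positivity
  ext i j
  fin_cases i <;> fin_cases j <;>
    simp [kerrMetric, kerrSigma, kerrDelta, schwarzschildMetric] <;> field_simp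
  ring

theorem kerrMetric_zero_apply {M : ℝ} {x : Vec} (hx : x ∈ schwarzschildRegular M) (μ ν : Fin 4) :
    kerrMetric M 0 x μ ν = if μ = ν then schwarzschildMetric M (x 1) (x 2) μ else 0 := by
  rw [kerrMetric_zero hx, Matrix.diagonal_apply]

theorem schwarzschildMetric_ne_zero {M : ℝ} {x : Vec} (hx : x ∈ schwarzschildRegular M)
    (μ : Fin 4) : schwarzschildMetric M (x 1) (x 2) μ ≠ 0 := by
  obtain ⟨h1, h2, h3⟩ := hx
  fin_cases μ <;> simp [schwarzschildMetric, h1, h2, h3]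

theorem ginv_kerrMetric_zero {M : ℝ} {x : Vec} (hx : x ∈ schwarzschildRegular M) (μ ν : Fin 4) :
    ginv (kerrMetric M 0) x μ ν =
      if μ = ν then (schwarzschildMetric M (x 1) (x 2) μ)⁻¹ else 0 := by
  have h : (kerrMetric M 0 x)⁻¹ =
      Matrix.diagonal (fun i => (schwarzschildMetric M (x 1) (x 2) i)⁻¹) := by
    refine Matrix.inv_eq_right_inv ?_
    rw [kerrMetric_zero hx, Matrix.diagonal_mul_diagonal, ← Matrix.diagonal_one]
    congr 1
    ext i
    exact mul_inv_cancel₀ (schwarzschildMetric_ne_zero hx i)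
  rw [ginv, h, Matrix.diagonal_apply]

/-- The Christoffel symbols `Γ^μ_{αβ}` of Schwarzschild spacetime as functions of `r` and `θ`. -/
noncomputable def schwarzschildChristoffel (M r θ : ℝ) : Fin 4 → Matrix (Fin 4) (Fin 4) ℝ :=
  ![!![0, M / (r * (r - 2 * M)), 0, 0;
      M / (r * (r - 2 * M)), 0, 0, 0;
      0, 0, 0, 0;
      0, 0, 0, 0],
    !![M * (r - 2 * M) / r ^ 3, 0, 0, 0;
      0, -(M / (r * (r - 2 * M))), 0, 0;
      0, 0, -(r - 2 * M), 0;
      0, 0, 0, -((r - 2 * M) * Real.sin θ ^ 2)],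
    !![0, 0, 0, 0;
      0, 0, 1 / r, 0;
      0, 1 / r, 0, 0;
      0, 0, 0, -(Real.sin θ * Real.cos θ)],
    !![0, 0, 0, 0;
      0, 0, 0, 1 / r;
      0, 0, 0, Real.cos θ / Real.sin θ;
      0, 1 / r, Real.cos θ / Real.sin θ, 0]]

theorem pd_kerrMetric_zero {M : ℝ} {x : Vec} (hx : x ∈ schwarzschildRegular M) (l μ ν : Fin 4) :
    pd l (fun y => kerrMetric M 0 y μ ν) x =
      if μ = ν then
        ![0, ![-(2 * M / x 1 ^ 2), -(2 * M / (x 1 - 2 * M) ^ 2), 2 * x 1,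
            2 * x 1 * Real.sin (x 2) ^ 2] μ,
          ![0, 0, 0, 2 * x 1 ^ 2 * Real.sin (x 2) * Real.cos (x 2)] μ, 0] l
      else 0 := by
  rw [pd_congr_of_eqOn (isOpen_schwarzschildRegular M)
    (h := fun y => if μ = ν then schwarzschildMetric M (y 1) (y 2) μ else 0)
    (fun y hy => kerrMetric_zero_apply hy μ ν) hx]
  obtain ⟨h1, h2, h3⟩ := hx
  split_ifs
  · refine pd_eq_of_hasDerivAt (F := fun r θ => schwarzschildMetric M r θ μ) ?_ ?_ l
    · fin_cases μ
      · refine ((((hasDerivAt_id (x 1)).sub_const (2 * M)).div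
          (hasDerivAt_id (x 1)) h1).neg).congr_deriv ?_
        simp
      · refine ((hasDerivAt_id (x 1)).div
          ((hasDerivAt_id (x 1)).sub_const (2 * M)) h2).congr_deriv ?_
        simp
        field_simp
      · simpa [schwarzschildMetric] using hasDerivAt_pow 2 (x 1)
      · simpa [schwarzschildMetric] using (hasDerivAt_pow 2 (x 1)).mul_const (Real.sin (x 2) ^ 2)
    · fin_cases μ
      · simpa [schwarzschildMetric] using hasDerivAt_const (x 2) _
      · simpa [schwarzschildMetric] using hasDerivAt_const (x 2) _
      · simpa [schwarzschildMetric] using hasDerivAt_const (x 2) _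
      · refine (((Real.hasDerivAt_sin (x 2)).pow 2).const_mul (x 1 ^ 2)).congr_deriv ?_
        simp
        ring
  · simp [pd]

theorem christoffel_kerrMetric_zero {M : ℝ} {x : Vec} (hx : x ∈ schwarzschildRegular M)
    (μ α β : Fin 4) : christoffel (kerrMetric M 0) x μ α β =
      schwarzschildChristoffel M (x 1) (x 2) μ α β := by
  simp only [christoffel, ginv_kerrMetric_zero hx, pd_kerrMetric_zero hx, ite_mul, zero_mul,
    Finset.sum_ite_eq, Finset.mem_univ, if_true]
  obtain ⟨h1, h2, h3⟩ := hx
  fin_cases μ <;> fin_cases α <;> fin_cases β <;>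
    simp [schwarzschildMetric, schwarzschildChristoffel] <;> field_simp
  ring

theorem hasDerivAt_schwarzschildChristoffel_r {M r θ : ℝ} (hr : r ≠ 0) (hM : r - 2 * M ≠ 0)
    (μ α β : Fin 4) : HasDerivAt (fun s => schwarzschildChristoffel M s θ μ α β)
    ((![!![0, -(2 * M * (r - M) / (r * (r - 2 * M)) ^ 2), 0, 0;
      -(2 * M * (r - M) / (r * (r - 2 * M)) ^ 2), 0, 0, 0;
      0, 0, 0, 0;
      0, 0, 0, 0],
    !![-(2 * M * (r - 3 * M) / r ^ 4), 0, 0, 0;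
      0, 2 * M * (r - M) / (r * (r - 2 * M)) ^ 2, 0, 0;
      0, 0, -1, 0;
      0, 0, 0, -(Real.sin θ ^ 2)],
    !![0, 0, 0, 0;
      0, 0, -(1 / r ^ 2), 0;
      0, -(1 / r ^ 2), 0, 0;
      0, 0, 0, 0],
    !![0, 0, 0, 0;
      0, 0, 0, -(1 / r ^ 2);
      0, 0, 0, 0;
      0, -(1 / r ^ 2), 0, 0]] : Fin 4 → Matrix (Fin 4) (Fin 4) ℝ) μ α β) r := by
  have hs : HasDerivAt (fun s : ℝ => s - 2 * M) 1 r := (hasDerivAt_id r).sub_const _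
  have d1 : HasDerivAt (fun s => M / (s * (s - 2 * M)))
      (-(2 * M * (r - M) / (r * (r - 2 * M)) ^ 2)) r := by
    refine ((hasDerivAt_const r M).div ((hasDerivAt_id r).mul hs)
      (mul_ne_zero hr hM)).congr_deriv ?_
    simp
    field_simp
    ring
  have d1n : HasDerivAt (fun s => -(M / (s * (s - 2 * M))))
      (2 * M * (r - M) / (r * (r - 2 * M)) ^ 2) r := d1.neg.congr_deriv (neg_neg _)
  have d5 : HasDerivAt (fun s => -((s - 2 * M) * Real.sin θ ^ 2)) (-(Real.sin θ ^ 2)) r :=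
    (hs.mul_const (Real.sin θ ^ 2)).neg.congr_deriv (by rw [one_mul])
  have d2 : HasDerivAt (fun s => M * (s - 2 * M) / s ^ 3) (-(2 * M * (r - 3 * M) / r ^ 4)) r := by
    refine ((hs.const_mul M).div (hasDerivAt_pow 3 r) (pow_ne_zero 3 hr)).congr_deriv ?_
    simp
    field_simp
    ring
  have d3 : HasDerivAt (fun s : ℝ => s⁻¹) (-(r ^ 2)⁻¹) r := hasDerivAt_inv hr
  have d4 : HasDerivAt (fun s : ℝ => 2 * M - s) (-1) r := by
    simpa using (hasDerivAt_id r).const_sub (2 * M)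
  fin_cases μ <;> fin_cases α <;> fin_cases β <;> simp [schwarzschildChristoffel] <;>
    first
    | exact hasDerivAt_const r _
    | exact d1
    | exact d1n
    | exact d2
    | exact d3
    | exact d4
    | exact d5

theorem hasDerivAt_schwarzschildChristoffel_θ {M r θ : ℝ} (hθ : Real.sin θ ≠ 0)
    (μ α β : Fin 4) : HasDerivAt (fun s => schwarzschildChristoffel M r s μ α β)
    ((![0,
    !![0, 0, 0, 0;
      0, 0, 0, 0;
      0, 0, 0, 0;
      0, 0, 0, -((r - 2 * M) * (2 * Real.sin θ * Real.cos θ))],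
    !![0, 0, 0, 0;
      0, 0, 0, 0;
      0, 0, 0, 0;
      0, 0, 0, Real.sin θ ^ 2 - Real.cos θ ^ 2],
    !![0, 0, 0, 0;
      0, 0, 0, 0;
      0, 0, 0, -1 - Real.cos θ ^ 2 / Real.sin θ ^ 2;
      0, 0, -1 - Real.cos θ ^ 2 / Real.sin θ ^ 2, 0]] :
        Fin 4 → Matrix (Fin 4) (Fin 4) ℝ) μ α β) θ := by
  have hs := Real.hasDerivAt_sin θ
  have hc := Real.hasDerivAt_cos θ
  have d1 : HasDerivAt (fun s => (r - 2 * M) * Real.sin s ^ 2)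
      ((r - 2 * M) * (2 * Real.sin θ * Real.cos θ)) θ := by
    simpa using (hs.pow 2).const_mul (r - 2 * M)
  have d2 : HasDerivAt (fun s => -(Real.sin s * Real.cos s))
      (Real.sin θ ^ 2 - Real.cos θ ^ 2) θ := by
    refine (hs.mul hc).neg.congr_deriv ?_
    ring
  have d3 : HasDerivAt (fun s => Real.cos s / Real.sin s)
      (-1 - Real.cos θ ^ 2 / Real.sin θ ^ 2) θ := by
    refine (hc.div hs hθ).congr_deriv ?_
    field_simp
  fin_cases μ <;> fin_cases α <;> fin_cases β <;> simp [schwarzschildChristoffel] <;>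
    first
    | exact hasDerivAt_const θ _
    | exact d1.neg
    | exact d2
    | exact d3

/-! ### The Riemann tensor -/

theorem pd_christoffel_kerrMetric_zero {M : ℝ} {x : Vec} (hx : x ∈ schwarzschildRegular M)
    (l μ α β : Fin 4) : pd l (fun y => christoffel (kerrMetric M 0) y μ α β) x =
      ![0, deriv (fun s => schwarzschildChristoffel M s (x 2) μ α β) (x 1),
        deriv (fun s => schwarzschildChristoffel M (x 1) s μ α β) (x 2), 0] l := by
  rw [pd_congr_of_eqOn (isOpen_schwarzschildRegular M)
    (h := fun y => schwarzschildChristoffel M (y 1) (y 2) μ α β)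
    (fun y hy => christoffel_kerrMetric_zero hy μ α β) hx]
  have hr := hasDerivAt_schwarzschildChristoffel_r (θ := x 2) hx.1 hx.2.1 μ α β
  have hθ := hasDerivAt_schwarzschildChristoffel_θ (M := M) (r := x 1) hx.2.2 μ α β
  rw [hr.deriv, hθ.deriv]
  exact pd_eq_of_hasDerivAt (F := fun r θ => schwarzschildChristoffel M r θ μ α β) hr hθ l

/-- The sectional curvatures of the coordinate planes of Schwarzschild spacetime: `2M/r³` for the
planes `(t, r)` and `(θ, φ)`, and `-M/r³` for the four others. The diagonal entries play no
role. -/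
noncomputable def sectionalCurvature (M r : ℝ) : Matrix (Fin 4) (Fin 4) ℝ :=
  !![0, 2 * M / r ^ 3, -(M / r ^ 3), -(M / r ^ 3);
    2 * M / r ^ 3, 0, -(M / r ^ 3), -(M / r ^ 3);
    -(M / r ^ 3), -(M / r ^ 3), 0, 2 * M / r ^ 3;
    -(M / r ^ 3), -(M / r ^ 3), 2 * M / r ^ 3, 0]

/-- The component `(μ, ν)` of the simple bivector `dx^a ∧ dx^b`. -/
def coordBivector (a b μ ν : Fin 4) : ℝ :=
  (if a = μ ∧ b = ν then 1 else 0) - if a = ν ∧ b = μ then 1 else 0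

set_option maxHeartbeats 4000000 in
/-- Each coordinate plane is an eigenplane of the curvature operator:
`R^μ_{ναβ} = k_{μν} g_{νν} (δ^μ_α δ^ν_β - δ^μ_β δ^ν_α)`, without summation. -/
theorem riemann_kerrMetric_zero {M : ℝ} {x : Vec} (hx : x ∈ schwarzschildRegular M)
    (μ ν α β : Fin 4) : riemann (kerrMetric M 0) x μ ν α β =
      sectionalCurvature M (x 1) μ ν * schwarzschildMetric M (x 1) (x 2) ν *
        coordBivector μ ν α β := by
  simp only [riemann, pd_christoffel_kerrMetric_zero hx, christoffel_kerrMetric_zero hx,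
    (hasDerivAt_schwarzschildChristoffel_r hx.1 hx.2.1 _ _ _).deriv,
    (hasDerivAt_schwarzschildChristoffel_θ hx.2.2 _ _ _).deriv]
  obtain ⟨h1, h2, h3⟩ := hx
  -- `field_simp` normalizes `r - 2M` to this form
  have h2' : x 1 - M * 2 ≠ 0 := by rwa [mul_comm]
  fin_cases μ <;> fin_cases ν <;> fin_cases α <;> fin_cases β <;>
    simp [Fin.sum_univ_four, schwarzschildMetric, schwarzschildChristoffel,
      sectionalCurvature, coordBivector] <;> field_simp <;> ring

theorem riemannDown_kerrMetric_zero {M : ℝ} {x : Vec} (hx : x ∈ schwarzschildRegular M)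
    (μ ν α β : Fin 4) : riemannDown (kerrMetric M 0) x μ ν α β =
      schwarzschildMetric M (x 1) (x 2) μ * (sectionalCurvature M (x 1) μ ν *
        schwarzschildMetric M (x 1) (x 2) ν *
        coordBivector μ ν α β) := by
  simp [riemannDown, kerrMetric_zero_apply hx, riemann_kerrMetric_zero hx]

/-! ### The angular covariant derivatives of the Riemann tensor -/

theorem coordBivector_self (a μ ν : Fin 4) : coordBivector a a μ ν = 0 := by
  simp [coordBivector, and_comm]

theorem coordBivector_swap (a b μ ν : Fin 4) :
    coordBivector b a μ ν = -coordBivector a b μ ν := by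
  simp [coordBivector, and_comm]

/-- The action of a matrix `Γ` on the lower indices of `coordBivector μ ν` is moved to its labels.
This leaves `α` and `β` as free indices when components of `∇R` are computed. -/
theorem sum_coordBivector_derivation (Γ : Fin 4 → Fin 4 → ℝ) (μ ν α β : Fin 4) :
    ∑ s, (Γ s α * coordBivector μ ν s β + Γ s β * coordBivector μ ν α s) =
      ∑ s, (Γ μ s * coordBivector s ν α β + Γ ν s * coordBivector μ s α β) := by
  simp [coordBivector, mul_sub, ite_and, Finset.sum_add_distrib, Finset.sum_sub_distrib]
  ring

/-- The covariant derivative of the Riemann tensor, with `Γ` acting on the first pair of indices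
only. -/
theorem nablaRiemann_kerrMetric_zero {M : ℝ} {x : Vec} (hx : x ∈ schwarzschildRegular M)
    (l μ ν α β : Fin 4) : nablaRiemann (kerrMetric M 0) x l μ ν α β =
      pd l (fun y => riemannDown (kerrMetric M 0) y μ ν α β) x
        - (∑ s, (schwarzschildChristoffel M (x 1) (x 2) s l μ *
              (schwarzschildMetric M (x 1) (x 2) s * (sectionalCurvature M (x 1) s ν *
                schwarzschildMetric M (x 1) (x 2) ν * coordBivector s ν α β))
            + schwarzschildChristoffel M (x 1) (x 2) s l ν *
              (schwarzschildMetric M (x 1) (x 2) μ * (sectionalCurvature M (x 1) μ s *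
                schwarzschildMetric M (x 1) (x 2) s * coordBivector μ s α β)))
          + schwarzschildMetric M (x 1) (x 2) μ * sectionalCurvature M (x 1) μ ν *
              schwarzschildMetric M (x 1) (x 2) ν *
            ∑ s, (schwarzschildChristoffel M (x 1) (x 2) μ l s * coordBivector s ν α β
              + schwarzschildChristoffel M (x 1) (x 2) ν l s * coordBivector μ s α β)) := by
  rw [← sum_coordBivector_derivation (fun a b => schwarzschildChristoffel M (x 1) (x 2) a l b)]
  simp only [nablaRiemann, christoffel_kerrMetric_zero hx, riemannDown_kerrMetric_zero hx]
  rw [Finset.mul_sum, ← Finset.sum_add_distrib]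
  congr 1
  refine Finset.sum_congr rfl fun s _ => ?_
  ring

/-- `∇_θ R` mixes the planes `(t, r)`, `(t, θ)` and the planes `(r, φ)`, `(θ, φ)`, whose sectional
curvatures differ by `3M/r³`. -/
theorem nablaRiemann_θ_kerrMetric_zero {M : ℝ} {x : Vec} (hx : x ∈ schwarzschildRegular M)
    (μ ν α β : Fin 4) : nablaRiemann (kerrMetric M 0) x 2 μ ν α β =
      -(3 * M * (x 1 - 2 * M) / x 1 ^ 3) *
          (coordBivector 0 1 μ ν * coordBivector 0 2 α β
            + coordBivector 0 2 μ ν * coordBivector 0 1 α β)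
        - 3 * M * Real.sin (x 2) ^ 2 *
          (coordBivector 1 3 μ ν * coordBivector 2 3 α β
            + coordBivector 2 3 μ ν * coordBivector 1 3 α β) := by
  have hpd : pd 2 (fun y => riemannDown (kerrMetric M 0) y μ ν α β) x =
      ((if μ = 3 then 2 * x 1 ^ 2 * Real.sin (x 2) * Real.cos (x 2) *
          schwarzschildMetric M (x 1) (x 2) ν else 0)
        + (if ν = 3 then 2 * x 1 ^ 2 * Real.sin (x 2) * Real.cos (x 2) *
          schwarzschildMetric M (x 1) (x 2) μ else 0)) *
        sectionalCurvature M (x 1) μ ν * coordBivector μ ν α β := by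
    have hg : ∀ μ, HasDerivAt (fun θ => schwarzschildMetric M (x 1) θ μ)
        (if μ = 3 then 2 * x 1 ^ 2 * Real.sin (x 2) * Real.cos (x 2) else 0) (x 2) := by
      intro μ
      fin_cases μ
      · simpa [schwarzschildMetric] using hasDerivAt_const (x 2) _
      · simpa [schwarzschildMetric] using hasDerivAt_const (x 2) _
      · simpa [schwarzschildMetric] using hasDerivAt_const (x 2) _
      · refine (((Real.hasDerivAt_sin (x 2)).pow 2).const_mul (x 1 ^ 2)).congr_deriv ?_
        simp
        ring
    rw [pd_congr_of_eqOn (isOpen_schwarzschildRegular M)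
      (fun y hy => riemannDown_kerrMetric_zero hy μ ν α β) hx]
    have := ((hg μ).mul (((hg ν).const_mul (sectionalCurvature M (x 1) μ ν)).mul_const
      (coordBivector μ ν α β))).deriv
    simp only [pd, Function.update_self]
    refine Eq.trans ?_ (this.trans ?_)
    · simp
      rfl
    · split_ifs <;> ring
  rw [nablaRiemann_kerrMetric_zero hx, hpd]
  obtain ⟨h1, h2, h3⟩ := hx
  have h2' : x 1 - M * 2 ≠ 0 := by rwa [mul_comm]
  have hself (a : Fin 4) : coordBivector a a α β = 0 := coordBivector_self a α β
  have hswap (a b : Fin 4) : coordBivector b a α β = -coordBivector a b α β :=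
    coordBivector_swap a b α β
  clear hpd
  -- `α` and `β` stay symbolic, so that only the 16 values of `(μ, ν)` have to be treated
  generalize hB : (fun a b => coordBivector a b α β) = B
  replace hB (a b : Fin 4) : coordBivector a b α β = B a b := congr_fun₂ hB a b
  simp only [hB] at hself hswap ⊢
  fin_cases μ <;> fin_cases ν <;>
    simp [Fin.sum_univ_four, schwarzschildMetric, schwarzschildChristoffel, sectionalCurvature,
      coordBivector, hself, hswap 0 1, hswap 0 2, hswap 0 3, hswap 1 2, hswap 1 3,
      hswap 2 3] <;> field_simp <;> ring

/-- `∇_φ R` mixes the planes `(t, r)`, `(t, φ)` and the planes `(r, θ)`, `(φ, θ)`, whose sectional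
curvatures differ by `3M/r³`. -/
theorem nablaRiemann_φ_kerrMetric_zero {M : ℝ} {x : Vec} (hx : x ∈ schwarzschildRegular M)
    (μ ν α β : Fin 4) : nablaRiemann (kerrMetric M 0) x 3 μ ν α β =
      -(3 * M * (x 1 - 2 * M) * Real.sin (x 2) ^ 2 / x 1 ^ 3) *
          (coordBivector 0 1 μ ν * coordBivector 0 3 α β
            + coordBivector 0 3 μ ν * coordBivector 0 1 α β)
        + 3 * M * Real.sin (x 2) ^ 2 *
          (coordBivector 1 2 μ ν * coordBivector 2 3 α β
            + coordBivector 2 3 μ ν * coordBivector 1 2 α β) := by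
  have hpd : pd 3 (fun y => riemannDown (kerrMetric M 0) y μ ν α β) x = 0 := by
    rw [pd_congr_of_eqOn (isOpen_schwarzschildRegular M)
      (fun y hy => riemannDown_kerrMetric_zero hy μ ν α β) hx]
    simp [pd]
  rw [nablaRiemann_kerrMetric_zero hx, hpd]
  obtain ⟨h1, h2, h3⟩ := hx
  have h2' : x 1 - M * 2 ≠ 0 := by rwa [mul_comm]
  have hself (a : Fin 4) : coordBivector a a α β = 0 := coordBivector_self a α β
  have hswap (a b : Fin 4) : coordBivector b a α β = -coordBivector a b α β :=
    coordBivector_swap a b α β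
  clear hpd
  -- `α` and `β` stay symbolic, so that only the 16 values of `(μ, ν)` have to be treated
  generalize hB : (fun a b => coordBivector a b α β) = B
  replace hB (a b : Fin 4) : coordBivector a b α β = B a b := congr_fun₂ hB a b
  simp only [hB] at hself hswap ⊢
  fin_cases μ <;> fin_cases ν <;>
    simp [Fin.sum_univ_four, schwarzschildMetric, schwarzschildChristoffel, sectionalCurvature,
      coordBivector, hself, hswap 0 1, hswap 0 2, hswap 0 3, hswap 1 2, hswap 1 3,
      hswap 2 3] <;> field_simp <;> ring

/-! ### The quadratic invariant as the square of the angular momentum -/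

theorem killingYanoMixed_zero {M : ℝ} {x : Vec} (hx : x ∈ schwarzschildRegular M)
    (μ ν : Fin 4) : killingYanoMixed M 0 x μ ν =
      (!![0, 0, 0, 0; 0, 0, 0, 0; 0, 0, 0, x 1 / Real.sin (x 2);
        0, 0, -(x 1 * Real.sin (x 2)), 0] : Matrix (Fin 4) (Fin 4) ℝ) μ ν := by
  simp only [killingYanoMixed, ginv_kerrMetric_zero hx, mul_ite, mul_zero,
    Finset.sum_ite_eq', Finset.mem_univ, if_true]
  obtain ⟨h1, h2, h3⟩ := hx
  fin_cases μ <;> fin_cases ν <;> simp [killingYano, schwarzschildMetric] <;> field_simp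

theorem killingTensor_zero {M : ℝ} {x : Vec} (hx : x ∈ schwarzschildRegular M) (μ ν : Fin 4) :
    killingTensor M 0 x μ ν =
      if μ = ν then ![0, 0, -(x 1 ^ 4), -(x 1 ^ 4 * Real.sin (x 2) ^ 2)] μ else 0 := by
  simp only [killingTensor, killingYanoMixed_zero hx]
  obtain ⟨h1, h2, h3⟩ := hx
  fin_cases μ <;> fin_cases ν <;> simp [killingYano, Fin.sum_univ_four] <;> field_simp

/-- `Y` lies in the plane `(θ, φ)` and `Y^*` in the plane `(t, r)`, so that `Y^*_{αβ} Y^{αβ} = 0`. -/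
theorem scalarZ_zero {M : ℝ} {x : Vec} (hx : x ∈ schwarzschildRegular M) : scalarZ M 0 x = 0 := by
  have hY : ∀ μ ν, raise2 (kerrMetric M 0) x (killingYano 0 x) μ ν =
      (schwarzschildMetric M (x 1) (x 2) μ)⁻¹ * (schwarzschildMetric M (x 1) (x 2) ν)⁻¹ *
        killingYano 0 x μ ν := by
    intro μ ν
    simp [raise2, ginv_kerrMetric_zero hx, Finset.sum_ite_eq]
  simp only [scalarZ, hodge, hY]
  simp [killingYano, leviCivita, permSymbol, Matrix.det_succ_row_zero, Fin.sum_univ_succ]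

theorem tensorL_zero {M : ℝ} {x : Vec} (hx : x ∈ schwarzschildRegular M) (α β γ : Fin 4) :
    tensorL M 0 x α β γ =
      (if β = γ then ![0, 0, -(x 1 ^ 3), -(x 1 ^ 3 * Real.sin (x 2) ^ 2)] β *
          (if α = 1 then 1 else 0) else 0)
      - (if α = γ then ![0, 0, -(x 1 ^ 3), -(x 1 ^ 3 * Real.sin (x 2) ^ 2)] α *
          (if β = 1 then 1 else 0) else 0) := by
  have hZ : ∀ l, pd l (scalarZ M 0) x = 0 := by
    intro l
    rw [pd_congr_of_eqOn (isOpen_schwarzschildRegular M) (h := fun _ => 0)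
      (fun y hy => scalarZ_zero hy) hx]
    simp [pd]
  have hK : ∀ l μ ν, pd l (fun y => killingTensor M 0 y μ ν) x = if μ = ν then
      ![0, ![0, 0, -(4 * x 1 ^ 3), -(4 * x 1 ^ 3 * Real.sin (x 2) ^ 2)] μ,
        ![0, 0, 0, -(x 1 ^ 4 * (2 * Real.sin (x 2) * Real.cos (x 2)))] μ, 0] l else 0 := by
    intro l μ ν
    rw [pd_congr_of_eqOn (isOpen_schwarzschildRegular M)
      (fun y hy => killingTensor_zero hy μ ν) hx]
    split_ifs
    · refine pd_eq_of_hasDerivAt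
        (F := fun r θ => ![0, 0, -(r ^ 4), -(r ^ 4 * Real.sin θ ^ 2)] μ) ?_ ?_ l
      · have h4 : HasDerivAt (fun r : ℝ => r ^ 4) (4 * x 1 ^ 3) (x 1) := by
          simpa using hasDerivAt_pow 4 (x 1)
        fin_cases μ
        · simpa using hasDerivAt_const (x 1) (0 : ℝ)
        · simpa using hasDerivAt_const (x 1) (0 : ℝ)
        · exact h4.neg
        · exact (h4.mul_const (Real.sin (x 2) ^ 2)).neg
      · fin_cases μ
        · simpa using hasDerivAt_const (x 2) (0 : ℝ)
        · simpa using hasDerivAt_const (x 2) (0 : ℝ)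
        · simpa using hasDerivAt_const (x 2) (-(x 1 ^ 4))
        · refine (((Real.hasDerivAt_sin (x 2)).pow 2).const_mul (x 1 ^ 4)).neg.congr_deriv ?_
          simp
    · simp [pd]
  simp only [tensorL, hZ, nabla2, hK, christoffel_kerrMetric_zero hx, killingTensor_zero hx,
    mul_zero, Finset.sum_const_zero, add_zero]
  obtain ⟨h1, h2, h3⟩ := hx
  fin_cases α <;> fin_cases β <;> fin_cases γ <;>
    simp [Fin.sum_univ_four, schwarzschildChristoffel] <;> field_simp <;> ring

/-- In Schwarzschild spacetime `Q_BH = -|J|²`, where the total angular momentum `J`, orbital plus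
spin, has the components `J_r = r² sin θ S^{θφ}`, `J_θ = -sin θ (r² p^φ + r S^{rφ})` and
`J_φ = r² p^θ + r S^{rθ}` along the orthonormal spherical frame of Euclidean space. The curvature
terms of `M_{αβγδ}` turn the factor `1 - 2M/r` of the square of `S^{θφ}` that comes from
`ξ² = -(1 - 2M/r)` into `1`. -/
theorem quadraticInvariantBH_zero {M : ℝ} {x : Vec} (hx : x ∈ schwarzschildRegular M) (p : Vec)
    {S : Tensor2} (hS : ∀ μ ν, S μ ν = -S ν μ) :
    quadraticInvariantBH M 0 x p S =
      -((x 1 ^ 2 * Real.sin (x 2) * S 2 3) ^ 2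
        + (x 1 ^ 2 * p 2 + x 1 * S 1 2) ^ 2
        + (Real.sin (x 2) * (x 1 ^ 2 * p 3 + x 1 * S 1 3)) ^ 2) := by
  simp only [quadraticInvariantBH, ruedigerInvariant, killingTensor_zero hx, tensorL_zero hx,
    tensorM, lower, dot, killingVector, kerrMetric_zero_apply hx, killingYanoMixed_zero hx,
    riemannDown_kerrMetric_zero hx]
  obtain ⟨h1, h2, h3⟩ := hx
  have h0 : ∀ μ, S μ μ = 0 := fun μ => by linarith [hS μ μ]
  have e1 := hS 1 0
  have e2 := hS 2 0
  have e3 := hS 3 0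
  have e4 := hS 2 1
  have e5 := hS 3 1
  have e6 := hS 3 2
  simp [Fin.sum_univ_four, schwarzschildMetric, sectionalCurvature, coordBivector, h0, e1,
    e2, e3, e4, e5, e6]
  field_simp
  ring

/-! ### The quadrupole force and torque -/

theorem sum_mul_coordBivector (T : Fin 4 → Fin 4 → ℝ) (a b : Fin 4) :
    ∑ μ, ∑ ν, T μ ν * coordBivector a b μ ν = T a b - T b a := by
  simp [coordBivector, mul_sub, Finset.sum_sub_distrib, ite_and]

theorem spinSquare_comm {g : MetricField} {x : Vec} (hg : (g x).IsSymm) (S : Tensor2)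
    (μ ν : Fin 4) : spinSquare g x S μ ν = spinSquare g x S ν μ := by
  rw [spinSquare, spinSquare, Finset.sum_comm]
  refine Finset.sum_congr rfl fun l _ => Finset.sum_congr rfl fun s _ => ?_
  rw [← hg.apply l s]
  ring

/-- Contraction of the quadrupole, which is symmetric under exchange of its two pairs of indices,
with a symmetrized product of two bivectors. -/
theorem sum_quadrupole_mul_coordBivector {g : MetricField} {x : Vec} (hg : (g x).IsSymm) (κ : ℝ)
    (v p : Vec) (S : Tensor2) (a b c d : Fin 4) :
    ∑ α, ∑ β, ∑ γ, ∑ δ, quadrupole g κ x v p S α β γ δ *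
        (coordBivector a b α β * coordBivector c d γ δ
          + coordBivector c d α β * coordBivector a b γ δ) =
      8 * quadrupole g κ x v p S a b c d := by
  have key : ∀ (T : Fin 4 → Fin 4 → Fin 4 → Fin 4 → ℝ) (a b c d : Fin 4),
      ∑ α, ∑ β, ∑ γ, ∑ δ, T α β γ δ * (coordBivector a b α β * coordBivector c d γ δ) =
        T a b c d - T a b d c - (T b a c d - T b a d c) := by
    intro T a b c d
    rw [← sum_mul_coordBivector (fun γ δ => T a b γ δ) c d,
      ← sum_mul_coordBivector (fun γ δ => T b a γ δ) c d,
      ← sum_mul_coordBivector (fun α β => ∑ γ, ∑ δ, T α β γ δ * coordBivector c d γ δ) a b]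
    simp only [Finset.sum_mul]
    refine Finset.sum_congr rfl fun α _ => Finset.sum_congr rfl fun β _ =>
      Finset.sum_congr rfl fun γ _ => Finset.sum_congr rfl fun δ _ => ?_
    ring
  simp only [mul_add, Finset.sum_add_distrib, key]
  simp only [quadrupole, spinSquare_comm hg S c a, spinSquare_comm hg S c b,
    spinSquare_comm hg S d a, spinSquare_comm hg S d b]
  ring

theorem isSymm_kerrMetric (M a : ℝ) (x : Vec) : (kerrMetric M a x).IsSymm := by
  ext i j
  fin_cases i <;> fin_cases j <;> rfl

theorem force_θ_kerrMetric_zero {M : ℝ} {x : Vec} (hx : x ∈ schwarzschildRegular M) (κ : ℝ)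
    (v p : Vec) (S : Tensor2) :
    x 1 ^ 2 * force (kerrMetric M 0) κ x v p S 2 =
      4 * M * ((x 1 - 2 * M) / x 1 ^ 3 * quadrupole (kerrMetric M 0) κ x v p S 0 1 0 2
        + Real.sin (x 2) ^ 2 * quadrupole (kerrMetric M 0) κ x v p S 1 3 2 3) := by
  have h1 := hx.1
  have h (α β γ δ : Fin 4) : quadrupole (kerrMetric M 0) κ x v p S α β γ δ *
      nablaRiemann (kerrMetric M 0) x 2 α β γ δ =
      -(3 * M * (x 1 - 2 * M) / x 1 ^ 3) * (quadrupole (kerrMetric M 0) κ x v p S α β γ δ *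
          (coordBivector 0 1 α β * coordBivector 0 2 γ δ
            + coordBivector 0 2 α β * coordBivector 0 1 γ δ))
        + -(3 * M * Real.sin (x 2) ^ 2) * (quadrupole (kerrMetric M 0) κ x v p S α β γ δ *
          (coordBivector 1 3 α β * coordBivector 2 3 γ δ
            + coordBivector 2 3 α β * coordBivector 1 3 γ δ)) := by
    rw [nablaRiemann_θ_kerrMetric_zero hx]
    ring
  simp only [force, ginv_kerrMetric_zero hx, ite_mul, zero_mul, Finset.sum_ite_eq,
    Finset.mem_univ, if_true, h, Finset.sum_add_distrib, ← Finset.mul_sum,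
    sum_quadrupole_mul_coordBivector (isSymm_kerrMetric M 0 x)]
  simp [schwarzschildMetric]
  field_simp
  ring

theorem force_φ_kerrMetric_zero {M : ℝ} {x : Vec} (hx : x ∈ schwarzschildRegular M) (κ : ℝ)
    (v p : Vec) (S : Tensor2) :
    x 1 ^ 2 * force (kerrMetric M 0) κ x v p S 3 =
      4 * M * ((x 1 - 2 * M) / x 1 ^ 3 * quadrupole (kerrMetric M 0) κ x v p S 0 1 0 3
        - quadrupole (kerrMetric M 0) κ x v p S 1 2 2 3) := by
  obtain ⟨h1, h2, h3⟩ := id hx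
  have h (α β γ δ : Fin 4) : quadrupole (kerrMetric M 0) κ x v p S α β γ δ *
      nablaRiemann (kerrMetric M 0) x 3 α β γ δ =
      -(3 * M * (x 1 - 2 * M) * Real.sin (x 2) ^ 2 / x 1 ^ 3) *
        (quadrupole (kerrMetric M 0) κ x v p S α β γ δ *
          (coordBivector 0 1 α β * coordBivector 0 3 γ δ
            + coordBivector 0 3 α β * coordBivector 0 1 γ δ))
        + 3 * M * Real.sin (x 2) ^ 2 * (quadrupole (kerrMetric M 0) κ x v p S α β γ δ *
          (coordBivector 1 2 α β * coordBivector 2 3 γ δ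
            + coordBivector 2 3 α β * coordBivector 1 2 γ δ)) := by
    rw [nablaRiemann_φ_kerrMetric_zero hx]
    ring
  simp only [force, ginv_kerrMetric_zero hx, ite_mul, zero_mul, Finset.sum_ite_eq,
    Finset.mem_univ, if_true, h, Finset.sum_add_distrib, ← Finset.mul_sum,
    sum_quadrupole_mul_coordBivector (isSymm_kerrMetric M 0 x)]
  simp [schwarzschildMetric]
  field_simp
  ring

theorem riemannQuadrupole_kerrMetric_zero {M : ℝ} {x : Vec} (hx : x ∈ schwarzschildRegular M)
    (κ : ℝ) (v p : Vec) (S : Tensor2) (μ ν : Fin 4) :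
    riemannQuadrupole (kerrMetric M 0) κ x v p S μ ν =
      2 * ∑ α, sectionalCurvature M (x 1) μ α * schwarzschildMetric M (x 1) (x 2) α *
        quadrupole (kerrMetric M 0) κ x v p S ν α μ α := by
  rw [riemannQuadrupole, Finset.mul_sum]
  refine Finset.sum_congr rfl fun α _ => ?_
  have h (β γ : Fin 4) : riemann (kerrMetric M 0) x μ α β γ *
      quadrupole (kerrMetric M 0) κ x v p S ν α β γ =
      sectionalCurvature M (x 1) μ α * schwarzschildMetric M (x 1) (x 2) α *
        (quadrupole (kerrMetric M 0) κ x v p S ν α β γ * coordBivector μ α β γ) := by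
    rw [riemann_kerrMetric_zero hx]
    ring
  simp only [h, ← Finset.mul_sum, sum_mul_coordBivector]
  simp only [quadrupole]
  ring

/-- The quadrupole force and torque do not act on `J_φ`: with the next two lemmas, this is the
invariance of the Riemann tensor under rotations, `J^{αβγδ} (ℒ_k R)_{αβγδ} = 0` for the Killing
vector fields `k` of the sphere. It uses only the symmetries of the quadrupole, hence no specific
value of `κ`. -/
theorem force_θ_add_torque {M : ℝ} {x : Vec} (hx : x ∈ schwarzschildRegular M) (κ : ℝ)
    (v p : Vec) (S : Tensor2) :
    x 1 ^ 2 * force (kerrMetric M 0) κ x v p S 2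
      + x 1 * torque (kerrMetric M 0) κ x v p S 1 2 = 0 := by
  have hΘ := spinSquare_comm (isSymm_kerrMetric M 0 x) S
  rw [force_θ_kerrMetric_zero hx]
  obtain ⟨h1, h2, h3⟩ := id hx
  simp [torque, riemannQuadrupole_kerrMetric_zero hx, Fin.sum_univ_four, sectionalCurvature,
    schwarzschildMetric, quadrupole, hΘ 1 0, hΘ 2 0, hΘ 2 1, hΘ 3 1, hΘ 3 2]
  field_simp
  ring

/-- The quadrupole force and torque do not act on `J_θ`. -/
theorem force_φ_add_torque {M : ℝ} {x : Vec} (hx : x ∈ schwarzschildRegular M) (κ : ℝ)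
    (v p : Vec) (S : Tensor2) :
    x 1 ^ 2 * force (kerrMetric M 0) κ x v p S 3
      + x 1 * torque (kerrMetric M 0) κ x v p S 1 3 = 0 := by
  have hΘ := spinSquare_comm (isSymm_kerrMetric M 0 x) S
  rw [force_φ_kerrMetric_zero hx]
  obtain ⟨h1, h2, h3⟩ := id hx
  simp [torque, riemannQuadrupole_kerrMetric_zero hx, Fin.sum_univ_four, sectionalCurvature,
    schwarzschildMetric, quadrupole, hΘ 1 0, hΘ 3 0, hΘ 2 1, hΘ 3 1, hΘ 3 2]
  field_simp
  ring

/-- The quadrupole torque does not act on `J_r`. -/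
theorem torque_θ_φ {M : ℝ} {x : Vec} (hx : x ∈ schwarzschildRegular M) (κ : ℝ)
    (v p : Vec) (S : Tensor2) : torque (kerrMetric M 0) κ x v p S 2 3 = 0 := by
  have hΘ := spinSquare_comm (isSymm_kerrMetric M 0 x) S
  obtain ⟨h1, h2, h3⟩ := id hx
  simp [torque, riemannQuadrupole_kerrMetric_zero hx, Fin.sum_univ_four, sectionalCurvature,
    schwarzschildMetric, quadrupole, hΘ 2 0, hΘ 3 0, hΘ 2 1, hΘ 3 1, hΘ 3 2]
  field_simp
  ring

/-! ### Conservation of the angular momentum -/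

/-- The radial component of `dJ/dτ = 0`: `dJ_r/dτ = θ' J_θ + sin θ φ' J_φ`. The right-hand sides
here and in the next two lemmas are the rates of rotation of the orthonormal spherical frame. -/
theorem IsMPDTrajectory.hasDerivAt_radial {M κ : ℝ} {U : Set Vec} {I : Set ℝ} {x v p : ℝ → Vec}
    {S : ℝ → Tensor2} (h : IsMPDTrajectory (kerrMetric M 0) U κ I x v p S)
    (hU : U ⊆ schwarzschildRegular M) {τ : ℝ} (hτ : τ ∈ I) :
    HasDerivAt (fun s => x s 1 ^ 2 * Real.sin (x s 2) * S s 2 3)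
      (Real.sin (x τ 2) * (v τ 3 * (x τ 1 ^ 2 * p τ 2 + x τ 1 * S τ 1 2)
        - v τ 2 * (x τ 1 ^ 2 * p τ 3 + x τ 1 * S τ 1 3))) τ := by
  have hx := hU (h.mem τ hτ)
  obtain ⟨h1, h2, h3⟩ := id hx
  have h0 : ∀ μ, S τ μ μ = 0 := fun μ => by linarith [h.antisymm τ hτ μ μ]
  refine ((((h.velocity τ hτ 1).pow 2).mul (h.velocity τ hτ 2).sin).mul
    (h.spin τ hτ 2 3)).congr_deriv ?_
  rw [torque_θ_φ hx]
  simp [christoffel_kerrMetric_zero hx, Fin.sum_univ_four, schwarzschildChristoffel,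
    h.antisymm τ hτ 2 1, h0]
  field_simp
  ring

/-- The component of `dJ/dτ = 0` along `φ`: `dJ_φ/dτ = -φ' (sin θ J_r + cos θ J_θ)`. -/
theorem IsMPDTrajectory.hasDerivAt_azimuthal {M κ : ℝ} {U : Set Vec} {I : Set ℝ}
    {x v p : ℝ → Vec} {S : ℝ → Tensor2} (h : IsMPDTrajectory (kerrMetric M 0) U κ I x v p S)
    (hU : U ⊆ schwarzschildRegular M) {τ : ℝ} (hτ : τ ∈ I) :
    HasDerivAt (fun s => x s 1 ^ 2 * p s 2 + x s 1 * S s 1 2)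
      (v τ 3 * (Real.cos (x τ 2) * (Real.sin (x τ 2) * (x τ 1 ^ 2 * p τ 3 + x τ 1 * S τ 1 3))
        - Real.sin (x τ 2) * (x τ 1 ^ 2 * Real.sin (x τ 2) * S τ 2 3))) τ := by
  have hx := hU (h.mem τ hτ)
  have hF := force_θ_add_torque hx κ (v τ) (p τ) (S τ)
  obtain ⟨h1, h2, h3⟩ := id hx
  have h0 : ∀ μ, S τ μ μ = 0 := fun μ => by linarith [h.antisymm τ hτ μ μ]
  refine ((((h.velocity τ hτ 1).pow 2).mul (h.momentum τ hτ 2)).add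
    ((h.velocity τ hτ 1).mul (h.spin τ hτ 1 2))).congr_deriv ?_
  generalize force (kerrMetric M 0) κ (x τ) (v τ) (p τ) (S τ) 2 = F at hF ⊢
  generalize torque (kerrMetric M 0) κ (x τ) (v τ) (p τ) (S τ) 1 2 = L at hF ⊢
  obtain rfl : L = -(x τ 1 * F) := mul_left_cancel₀ h1 (by linear_combination hF)
  simp [christoffel_kerrMetric_zero hx, riemann_kerrMetric_zero hx, Fin.sum_univ_four,
    schwarzschildChristoffel, schwarzschildMetric, sectionalCurvature, coordBivector, h0,
    h.antisymm τ hτ 1 0, h.antisymm τ hτ 2 0, h.antisymm τ hτ 2 1, h.antisymm τ hτ 3 2]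
  field_simp
  ring

/-- The component of `dJ/dτ = 0` along `θ`, for `-J_θ`: `dJ_θ/dτ = -θ' J_r + cos θ φ' J_φ`. -/
theorem IsMPDTrajectory.hasDerivAt_polar {M κ : ℝ} {U : Set Vec} {I : Set ℝ} {x v p : ℝ → Vec}
    {S : ℝ → Tensor2} (h : IsMPDTrajectory (kerrMetric M 0) U κ I x v p S)
    (hU : U ⊆ schwarzschildRegular M) {τ : ℝ} (hτ : τ ∈ I) :
    HasDerivAt (fun s => Real.sin (x s 2) * (x s 1 ^ 2 * p s 3 + x s 1 * S s 1 3))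
      (v τ 2 * (x τ 1 ^ 2 * Real.sin (x τ 2) * S τ 2 3)
        - v τ 3 * Real.cos (x τ 2) * (x τ 1 ^ 2 * p τ 2 + x τ 1 * S τ 1 2)) τ := by
  have hx := hU (h.mem τ hτ)
  have hF := force_φ_add_torque hx κ (v τ) (p τ) (S τ)
  obtain ⟨h1, h2, h3⟩ := id hx
  have h0 : ∀ μ, S τ μ μ = 0 := fun μ => by linarith [h.antisymm τ hτ μ μ]
  refine ((h.velocity τ hτ 2).sin.mul ((((h.velocity τ hτ 1).pow 2).mul (h.momentum τ hτ 3)).add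
    ((h.velocity τ hτ 1).mul (h.spin τ hτ 1 3)))).congr_deriv ?_
  generalize force (kerrMetric M 0) κ (x τ) (v τ) (p τ) (S τ) 3 = F at hF ⊢
  generalize torque (kerrMetric M 0) κ (x τ) (v τ) (p τ) (S τ) 1 3 = L at hF ⊢
  obtain rfl : L = -(x τ 1 * F) := mul_left_cancel₀ h1 (by linear_combination hF)
  simp [christoffel_kerrMetric_zero hx, riemann_kerrMetric_zero hx, Fin.sum_univ_four,
    schwarzschildChristoffel, schwarzschildMetric, sectionalCurvature, coordBivector, h0,
    h.antisymm τ hτ 1 0, h.antisymm τ hτ 3 0, h.antisymm τ hτ 3 1, h.antisymm τ hτ 3 2]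
  field_simp
  ring

/-- Exact conservation of `Q_BH = -|J|²`: a rotation of the frame does not change `|J|²`. -/
theorem IsMPDTrajectory.hasDerivAt_quadraticInvariantBH {M κ : ℝ} {U : Set Vec} {I : Set ℝ}
    {x v p : ℝ → Vec} {S : ℝ → Tensor2} (h : IsMPDTrajectory (kerrMetric M 0) U κ I x v p S)
    (hU : U ⊆ schwarzschildRegular M) {τ : ℝ} (hτ : τ ∈ I) :
    HasDerivAt (fun s => quadraticInvariantBH M 0 (x s) (p s) (S s)) 0 τ := by
  have hQ : HasDerivAt (fun s => -((x s 1 ^ 2 * Real.sin (x s 2) * S s 2 3) ^ 2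
      + (x s 1 ^ 2 * p s 2 + x s 1 * S s 1 2) ^ 2
      + (Real.sin (x s 2) * (x s 1 ^ 2 * p s 3 + x s 1 * S s 1 3)) ^ 2)) 0 τ := by
    refine ((((h.hasDerivAt_radial hU hτ).pow 2).add ((h.hasDerivAt_azimuthal hU hτ).pow 2)).add
      ((h.hasDerivAt_polar hU hτ).pow 2)).neg.congr_deriv ?_
    push_cast
    ring
  refine hQ.congr_of_eventuallyEq ?_
  filter_upwards [h.isOpen.mem_nhds hτ] with s hs
  exact quadraticInvariantBH_zero (hU (h.mem s hs)) (p s) (h.antisymm s hs)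

end SpinningBody


open SpinningBody
theorem mainTheorem3 (M : ℝ) (hM : 0 < M) (κ : ℝ)
    (K : Set ((Fin 4 → ℝ) × (Fin 4 → ℝ))) (hK : IsCompact K)
    (hKU : ∀ q ∈ K, q.1 ∈ schwarzschildPatch M ∧
      SpinningBody.dot (kerrMetric M 0) q.1 q.2 q.2 < 0) :
    ∃ C : ℝ, 0 < C ∧ ∃ ε : ℝ, 0 < ε ∧
      ∀ (I : Set ℝ) (x v p : ℝ → Fin 4 → ℝ) (S : ℝ → Fin 4 → Fin 4 → ℝ),
        IsMPDTrajectory (kerrMetric M 0) (schwarzschildPatch M) κ I x v p S →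
        ∀ τ ∈ I, (x τ, p τ) ∈ K →
          spinMagnitude (kerrMetric M 0) (x τ) (S τ) ≤ ε →
          DifferentiableAt ℝ (fun s => quadraticInvariantBH M 0 (x s) (p s) (S s)) τ ∧
          |deriv (fun s => quadraticInvariantBH M 0 (x s) (p s) (S s)) τ| ≤
            C * spinMagnitude (kerrMetric M 0) (x τ) (S τ) ^ 3 := by
  -- The derivative vanishes identically, so any positive constants will do.
  refine ⟨1, one_pos, 1, one_pos, fun I x v p S h τ hτ _ _ => ?_⟩
  have hQ := h.hasDerivAt_quadraticInvariantBH (schwarzschildPatch_subset_regular M) hτ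
  refine ⟨hQ.differentiableAt, ?_⟩
  rw [hQ.deriv, abs_zero, one_mul]
  exact pow_nonneg (Real.sqrt_nonneg _) 3
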